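/- Let $m,n\ge 1$. Let $w_1,\dots,w_{mn+1}$ be independent exponential random variables with mean $1$, $W_j=\sum_{i\le j}w_i$, $R_j=W_j/W_{mn+1}$ $(0\le j\le mn$, $R_0=0)$, and, conditionally on $(w_i)$, let $\ell_1,\dots,\ell_{mn}$ be independent, $\ell_k$ having density $\frac{1}{2\sqrt{R_k x}}$ on $(0,R_k]$. Let $G_m^n$ be the random multigraph on $[n]$ whose edges are the chords $k\in[mn]$: if $R_{u-1}<\ell_k\le R_u$, then chord $k$ joins the vertices $\lceil u/m\rceil$ and $\lceil k/m\rceil$ (the Bollobás–Riordan preferential attachment graph in its random pairing representation). There is a function $c=c(n)$, depending on $n$ only, with $c(n)\to\frac12$ as $n\to\infty$, such that the following holds for all $m,n\ge1$, all $\delta,\varepsilon\in(0,1)$ and all integers $\mu,\nu\ge0$ with $\mu+\nu=(1-\delta)n$. Let $$\mathcal W=\bigcap_{\delta n\le j\le n}\Bigl\{\frac{W_{mj}}{mj}\le 1+n^{-1/2}\log n\Bigr\},$$ and let $\mathbb P(\mu,\nu)$ be the probability that $\mathcal W$ holds and that there exist disjoint vertex sets $A,B\subset[n]$ with $|A|=\mu$,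 $|B|=\nu$ and no edge of $G_m^n$ joining $A$ and $B$. Then $$\mathbb P(\mu,\nu)\le 2\binom{n}{\mu+\nu}\binom{\mu+\nu}{\mu}\exp\bigl(-mH_{\varepsilon,\delta}(\mu,\nu)\bigr),$$ $$H_{\varepsilon,\delta}(\mu,\nu)=\min\Bigl\{\frac{2\varepsilon^2\sqrt\delta}{(1+\sqrt\delta)^2}\,\frac{\mu\nu}{\mu+\nu}\,;\ c(n)(1-\varepsilon)\,g(\mu,\nu)\Bigr\},$$ (with $\frac{\mu\nu}{\mu+\nu}=0$ if $\mu=\nu=0$), where $g(\mu,\nu)=\min\{h(\mu,\nu),h(\nu,\mu)\}$ and, with $N=n+1$, $$h(\mu,\nu)=4\bigl(\sqrt{N-\nu}-\sqrt{N-\mu-\nu}\bigr)\bigl(\sqrt N-\sqrt{N-\nu}\bigr).$$ -/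

import Mathlib

open MeasureTheory Filter Topology

namespace PairingModel

/-- The partial sum `W_j = w_1 + ⋯ + w_j` (the entry `w i` with `i : Fin M` is `w_{i+1}`). -/
noncomputable def W {M : ℕ} (w : Fin M → ℝ) (j : ℕ) : ℝ :=
  ∑ i : Fin M with i.val < j, w i

/-- The right endpoints `R_j = W_j / W_{N+1}`, with `R_0 = 0`. -/
noncomputable def R {N : ℕ} (w : Fin (N + 1) → ℝ) (j : ℕ) : ℝ :=
  W w j / W w (N + 1)

/-- The density `1 / (2 √(r x))` on `(0, r]` of the left endpoint matched with the right
endpoint `r`. -/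
noncomputable def leftDensity (r x : ℝ) : ENNReal :=
  if 0 < x ∧ x ≤ r then ENNReal.ofReal (1 / (2 * √(r * x))) else 0

/-- The joint law of `(w, ℓ)` in the pairing model with `N` chords: `w_1, …, w_{N+1}` are
independent exponentials with mean `1` and, conditionally on `w`, the left endpoints
`ℓ_1, …, ℓ_N` are independent, `ℓ_k` having density `1 / (2 √(R_k x))` on `(0, R_k]`.
The entry `ℓ k` with `k : Fin N` is `ℓ_{k+1}`, matched with `R_{k+1}`. -/
noncomputable def law (N : ℕ) : Measure ((Fin (N + 1) → ℝ) × (Fin N → ℝ)) :=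
  ((Measure.pi fun _ : Fin (N + 1) => ProbabilityTheory.expMeasure 1).prod
      (volume : Measure (Fin N → ℝ))).withDensity
    fun x => ∏ k : Fin N, leftDensity (R x.1 ((k : ℕ) + 1)) (x.2 k)

/-  The law is a probability measure. -/

lemma measurable_leftDensity : Measurable (fun p : ℝ × ℝ => leftDensity p.1 p.2) := by
  unfold leftDensity
  refine Measurable.ite ?_ (by fun_prop) measurable_const
  exact (measurableSet_lt measurable_const measurable_snd).inter (measurableSet_le measurable_snd measurable_fst)

lemma lintegral_leftDensity {r : ℝ} (hr : 0 < r) : ∫⁻ x, leftDensity r x = 1 := by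
  have h1 : (fun x => leftDensity r x) = (Set.Ioc 0 r).indicator (fun x => ENNReal.ofReal (1 / (2 * √(r * x)))) := by
    ext x; simp [leftDensity, Set.indicator, Set.mem_Ioc]
  rw [h1, lintegral_indicator measurableSet_Ioc]
  have e : Set.EqOn (fun x => 1 / (2 * √(r * x))) (fun x => (1/(2*√r)) * x ^ (-(1/2):ℝ)) (Set.Ioc 0 r) := by
    intro x hx
    simp only
    rw [Real.sqrt_mul hr.le, Real.rpow_neg hx.1.le, ← Real.sqrt_eq_rpow]
    field_simp
  have hi : IntegrableOn (fun x => (1/(2*√r)) * x ^ (-(1/2):ℝ)) (Set.Ioc 0 r) := by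
    rw [← intervalIntegrable_iff_integrableOn_Ioc_of_le hr.le]
    exact (intervalIntegral.intervalIntegrable_rpow' (by norm_num)).const_mul _
  rw [← ofReal_integral_eq_lintegral_ofReal]
  · rw [setIntegral_congr_fun measurableSet_Ioc e, ← intervalIntegral.integral_of_le hr.le,
      intervalIntegral.integral_const_mul, integral_rpow (Or.inl (by norm_num))]
    have h2 : (-(1/2) + 1 : ℝ) = 1/2 := by norm_num
    rw [h2, ← Real.sqrt_eq_rpow, Real.zero_rpow (by norm_num)]
    have := Real.sqrt_pos.2 hr
    rw [← ENNReal.ofReal_one]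
    congr 1
    field_simp
    norm_num
  · exact hi.congr_fun e.symm measurableSet_Ioc
  · exact Filter.Eventually.of_forall fun x => by positivity

lemma lintegral_prod_coord {N : ℕ} (f : Fin N → ℝ → ENNReal) (hf : ∀ k, Measurable (f k)) :
    ∫⁻ x : Fin N → ℝ, ∏ k, f k (x k) = ∏ k, ∫⁻ x, f k x := by
  induction N with
  | zero => simp [volume_pi, Measure.pi_empty_univ]
  | succ N ih =>
    have := (volume_preserving_piFinSuccAbove (fun _ : Fin (N+1) => ℝ) 0).symm
    rw [← this.lintegral_comp_emb (MeasurableEquiv.measurableEmbedding _)]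
    simp_rw [MeasurableEquiv.piFinSuccAbove_symm_apply, Fin.insertNthEquiv,
            Fin.prod_univ_succ, Fin.insertNth_zero, Equiv.coe_fn_mk, Fin.cons_succ, Fin.cons_zero]
    rw [← ih _ (fun k => hf _), Measure.volume_eq_prod, ← lintegral_prod_mul]
    · rfl
    · exact (hf 0).aemeasurable
    · exact (Finset.measurable_prod _ fun k _ => (hf _).comp (measurable_pi_apply k)).aemeasurable

lemma measurable_W {M : ℕ} (j : ℕ) : Measurable fun w : Fin M → ℝ => W w j := by
  unfold W; fun_prop

lemma W_pos {M : ℕ} {w : Fin M → ℝ} (hw : ∀ i, 0 < w i) {j : ℕ} (h0 : 0 < j) (hj : j ≤ M) :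
    0 < W w j :=
  Finset.sum_pos (fun i _ => hw i) ⟨⟨0, by omega⟩, by simp [h0]⟩

lemma ae_exp_pos (M : ℕ) :
    ∀ᵐ w ∂(Measure.pi fun _ : Fin M => ProbabilityTheory.expMeasure 1), ∀ i, 0 < w i := by
  have := ProbabilityTheory.isProbabilityMeasure_expMeasure one_pos
  have h : ∀ᵐ x ∂(ProbabilityTheory.expMeasure 1), 0 < x := by
    rw [ae_iff, ProbabilityTheory.expMeasure, ProbabilityTheory.gammaMeasure]
    simp only [not_lt]
    change (volume.withDensity (ProbabilityTheory.gammaPDF 1 1)) (Set.Iic 0) = 0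
    rw [withDensity_apply _ measurableSet_Iic, ← setLIntegral_congr Iio_ae_eq_Iic]
    exact ProbabilityTheory.lintegral_gammaPDF_of_nonpos le_rfl
  rw [ae_all_iff]
  exact fun i => (Measure.tendsto_eval_ae_ae (i := i)).eventually h

instance instIsProbabilityMeasureLaw (N : ℕ) : IsProbabilityMeasure (law N) := by
  have := ProbabilityTheory.isProbabilityMeasure_expMeasure one_pos
  constructor
  have hR : ∀ j, Measurable fun w : Fin (N + 1) → ℝ => R w j := fun j => (measurable_W _).div (measurable_W _)
  have hm : Measurable fun x : (Fin (N + 1) → ℝ) × (Fin N → ℝ) =>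
      ∏ k : Fin N, leftDensity (R x.1 ((k : ℕ) + 1)) (x.2 k) := by
    refine Finset.measurable_prod _ fun k _ => measurable_leftDensity.comp (Measurable.prodMk ((hR _).comp measurable_fst) ?_)
    fun_prop
  rw [law, withDensity_apply _ MeasurableSet.univ, setLIntegral_univ, lintegral_prod _ hm.aemeasurable]
  rw [lintegral_congr_ae (g := fun _ => 1), lintegral_one, measure_univ]
  filter_upwards [ae_exp_pos (N+1)] with w hw
  rw [lintegral_prod_coord (fun k : Fin N => leftDensity (R w ((k : ℕ) + 1))) (fun k => measurable_leftDensity.comp (measurable_const.prodMk measurable_id))]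
  refine Finset.prod_eq_one fun k _ => lintegral_leftDensity ?_
  exact div_pos (W_pos hw (by omega) (by omega)) (W_pos hw (by omega) le_rfl)

/-- The left endpoint of chord `k` belongs to vertex `u` of `G_1^N`, i.e. it lies between the
right endpoint of the preceding vertex (excluded) and that of `u` (included). -/
def LeftEndIn {N : ℕ} (w : Fin (N + 1) → ℝ) (l : Fin N → ℝ) (k u : Fin N) : Prop :=
  R w (u : ℕ) < l k ∧ l k ≤ R w ((u : ℕ) + 1)

/-- The multigraph `G_m^n` read off the linearized chord diagram of `n * m` chords.
Its edges are the chords. The right endpoint of chord `k` belongs to vertex `k` of `G_1^{mn}`, and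
its left endpoint to the (almost surely unique) vertex `u` of `G_1^{mn}` with `LeftEndIn w l k u`.
Each block of `m` consecutive vertices of `G_1^{mn}` is one vertex of `G_m^n`; the block of `k` is
`k.divNat`, the quotient of `k` by `m`. -/
def graph {n m : ℕ} (w : Fin (n * m + 1) → ℝ) (l : Fin (n * m) → ℝ) :
    Graph (Fin n) (Fin (n * m)) where
  vertexSet := Set.univ
  IsLink k a b := ∃ u : Fin (n * m), (∀ v, LeftEndIn w l k v ↔ v = u) ∧
    s(u.divNat, k.divNat) = s(a, b)
  isLink_symm := by
    intro k _
    refine ⟨?_⟩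
    rintro a b ⟨u, hu, h⟩
    exact ⟨u, hu, h.trans Sym2.eq_swap⟩
  eq_or_eq_of_isLink_of_isLink := by
    rintro k a b c d ⟨u, hu, h⟩ ⟨u', hu', h'⟩
    obtain rfl : u = u' := (hu' u).1 ((hu u).2 rfl)
    have h2 := h.symm.trans h'
    rw [Sym2.eq_iff] at h2
    rcases h2 with h2 | h2
    · exact Or.inl h2.1
    · exact Or.inr h2.1
  left_mem_of_isLink := fun _ _ _ _ => Set.mem_univ _

/-- The event `𝒲`: `W_{mj} / (mj) ≤ 1 + n^{-1/2} log n` for all integers `j ∈ [δ n, n]`. -/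
def EventW (n m : ℕ) (δ : ℝ) (w : Fin (n * m + 1) → ℝ) : Prop :=
  ∀ j : ℕ, δ * n ≤ j → j ≤ n →
    W w (m * j) / (m * j) ≤ 1 + (n : ℝ) ^ (-(1 / 2) : ℝ) * Real.log n

/-- There are disjoint vertex sets `A`, `B` of cardinalities `μ`, `ν` with no edge of the
multigraph joining them. -/
def HasSeparatedPair {n : ℕ} {E : Type*} (G : Graph (Fin n) E) (μ ν : ℕ) : Prop :=
  ∃ A B : Finset (Fin n), A.card = μ ∧ B.card = ν ∧ Disjoint A B ∧
    ∀ a ∈ A, ∀ b ∈ B, ¬ G.Adj a b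

/-- `ℙ(μ, ν)`: the probability that `𝒲` holds and `G_m^n` has disjoint vertex sets of
cardinalities `μ`, `ν` with no edge joining them. -/
noncomputable def prob (n m : ℕ) (δ : ℝ) (μ ν : ℕ) : ENNReal :=
  law (n * m) {x | EventW n m δ x.1 ∧ HasSeparatedPair (graph x.1 x.2) μ ν}

/-- `h(μ, ν)`, with `N = n + 1`. -/
noncomputable def h (n μ ν : ℕ) : ℝ :=
  4 * (√((n : ℝ) + 1 - ν) - √((n : ℝ) + 1 - μ - ν)) * (√((n : ℝ) + 1) - √((n : ℝ) + 1 - ν))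

/-- `g(μ, ν) = min (h(μ, ν), h(ν, μ))`. -/
noncomputable def g (n μ ν : ℕ) : ℝ := min (h n μ ν) (h n ν μ)

/-- The exponent `H_{ε,δ}(μ, ν)`, with the constant `c`. -/
noncomputable def H (n : ℕ) (c ε δ : ℝ) (μ ν : ℕ) : ℝ :=
  min (2 * ε ^ 2 * √δ / (1 + √δ) ^ 2 * ((μ : ℝ) * ν / ((μ : ℝ) + ν)))
    (c * (1 - ε) * g n μ ν)

end PairingModel

/-! A union bound over `(A, B)` produces the binomial factors, so fix one pair. Given `w`, the left
endpoints are independent, and chord `k` misses the intervals of the opposite earlier chords `u`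
with probability `1 - ∑ (√R_u - √R_{u-1}) / √R_k`. Since `1 - x ≤ exp (-x)`, separation has
conditional probability at most `exp (-X w)`, with `X` a double sum over crossing pairs
(`law_forall_notMem_le`).

Put `s = δ n = n - μ - ν`. On `𝒲`, monotonicity of `W` gives `W_u ≤ m * growth n * max ⌈u/m⌉ s`,
which bounds `X` below by `1 / (2 * growth n)` times a linear form in the `w_u` with nonnegative
deterministic coefficients (`le_sum_crossing`). Its mean is `m * F_A * F_B`, where `F_A`, `F_B` are
the total weights of `A`, `B`. Either the form falls below `1 - ε` times its mean, which has small
probability by Chernoff (`measure_sum_mul_le_exp`), or `X` is large. These two cases yield the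
factor `2` and the two terms of the minimum, with `c n = 1 / (2 * growth n)`.

Two deterministic facts finish: `F_A * F_B ≥ g` (`g_le_sum_weight_mul_sum_weight`), and a
Pólya–Szegő comparison of the coefficients' first and second moments
(`mul_div_mul_sum_slope_sq_le`). -/

namespace PairingModel

/-! ### Lower tails of weighted sums of exponential variables -/

/-- Tilting the density of mean `1` by `exp (-s x)` gives `1 / (1 + s)` times the exponential
density of rate `1 + s`; the bound is then `log (1 + s) ≥ 2 s / (s + 2) ≥ s - s ^ 2 / 2`. -/
lemma lintegral_exp_neg_mul_expMeasure_le {s : ℝ} (hs : 0 ≤ s) :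
    ∫⁻ x, ENNReal.ofReal (Real.exp (-(s * x))) ∂(ProbabilityTheory.expMeasure 1) ≤
      ENNReal.ofReal (Real.exp (-s + s ^ 2 / 2)) := by
  have hs1 : 0 < 1 + s := by linarith
  have h1 : ∫⁻ x, ENNReal.ofReal (Real.exp (-(s * x))) ∂(ProbabilityTheory.expMeasure 1) =
      ∫⁻ x, ENNReal.ofReal (1 / (1 + s)) * ProbabilityTheory.exponentialPDF (1 + s) x := by
    change ∫⁻ x, _ ∂(volume.withDensity (ProbabilityTheory.exponentialPDF 1)) = _
    rw [lintegral_withDensity_eq_lintegral_mul _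
      (f := ProbabilityTheory.exponentialPDF 1)
      (ProbabilityTheory.measurable_exponentialPDFReal 1).ennreal_ofReal (by fun_prop)]
    refine lintegral_congr fun x => ?_
    simp only [Pi.mul_apply, ProbabilityTheory.exponentialPDF_eq]
    rw [← ENNReal.ofReal_mul (by split_ifs <;> positivity), ← ENNReal.ofReal_mul (by positivity)]
    congr 1
    split_ifs
    · rw [one_mul, ← Real.exp_add]
      field_simp
      ring_nf
    · simp
  rw [h1, lintegral_const_mul (f := ProbabilityTheory.exponentialPDF (1 + s)) _
    (ProbabilityTheory.measurable_exponentialPDFReal (1 + s)).ennreal_ofReal,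
    ProbabilityTheory.lintegral_exponentialPDF_eq_one hs1, mul_one]
  refine ENNReal.ofReal_le_ofReal ?_
  rw [one_div, ← Real.exp_log hs1, ← Real.exp_neg, Real.exp_le_exp]
  have h2 := Real.le_log_one_add_of_nonneg hs
  have h3 : s - s ^ 2 / 2 ≤ 2 * s / (s + 2) := by
    rw [le_div_iff₀ (by linarith)]
    nlinarith [pow_nonneg hs 3]
  linarith

lemma lintegral_pi_prod_eq {ι : Type*} [Fintype ι] (P : Measure ℝ) [IsProbabilityMeasure P]
    (f : ι → ℝ → ENNReal) (hf : ∀ i, Measurable (f i)) :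
    ∫⁻ w, ∏ i, f i (w i) ∂(Measure.pi fun _ : ι => P) = ∏ i, ∫⁻ x, f i x ∂P := by
  have h := ProbabilityTheory.iIndepFun_pi (μ := fun _ : ι => P) (X := fun i => f i)
    (fun i => (hf i).aemeasurable)
  have h2 := ProbabilityTheory.lintegral_prod_eq_prod_lintegral_of_indepFun Finset.univ
    (fun i (w : ι → ℝ) => f i (w i)) h
    (fun i => (hf i).comp (measurable_pi_apply i))
  rw [h2]
  refine Finset.prod_congr rfl fun i _ => ?_
  exact (measurePreserving_eval (fun _ : ι => P) i).lintegral_comp (hf i)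

lemma measure_sum_mul_le_exp {ι : Type*} [Fintype ι] (β : ι → ℝ) (hβ : ∀ i, 0 ≤ β i)
    {ε : ℝ} (hε : 0 ≤ ε) :
    (Measure.pi fun _ : ι => ProbabilityTheory.expMeasure 1)
        {w | ∑ i, β i * w i ≤ (1 - ε) * ∑ i, β i} ≤
      ENNReal.ofReal (Real.exp (-(ε ^ 2 * (∑ i, β i) ^ 2 / (2 * ∑ i, β i ^ 2)))) := by
  have := ProbabilityTheory.isProbabilityMeasure_expMeasure one_pos
  set S := ∑ i, β i with hS
  set Q := ∑ i, β i ^ 2 with hQ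
  have hS0 : 0 ≤ S := Finset.sum_nonneg fun i _ => hβ i
  have hQ0 : 0 ≤ Q := Finset.sum_nonneg fun i _ => sq_nonneg _
  -- Minimizer of the Chernoff exponent `-t ε S + t ^ 2 Q / 2`. If `Q = 0`, division by zero makes
  -- `t = 0` and the claimed bound is `1`.
  set t := ε * S / Q with ht
  have ht0 : 0 ≤ t := by positivity
  have key : ∫⁻ w, ENNReal.ofReal (Real.exp (t * ((1 - ε) * S - ∑ i, β i * w i)))
      ∂(Measure.pi fun _ : ι => ProbabilityTheory.expMeasure 1) ≤
      ENNReal.ofReal (Real.exp (-(ε ^ 2 * S ^ 2 / (2 * Q)))) := by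
    have e : ∀ w : ι → ℝ, ENNReal.ofReal (Real.exp (t * ((1 - ε) * S - ∑ i, β i * w i))) =
        ENNReal.ofReal (Real.exp (t * ((1 - ε) * S))) *
          ∏ i, ENNReal.ofReal (Real.exp (-((t * β i) * w i))) := by
      intro w
      rw [← ENNReal.ofReal_prod_of_nonneg (fun i _ => (Real.exp_pos _).le), ← Real.exp_sum,
        ← ENNReal.ofReal_mul (Real.exp_pos _).le, ← Real.exp_add, Finset.sum_neg_distrib, mul_sub,
        Finset.mul_sum (f := fun i => β i * w i)]
      simp only [mul_assoc, sub_eq_add_neg]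
    simp_rw [e]
    rw [lintegral_const_mul _ (by fun_prop),
      lintegral_pi_prod_eq _ (fun i x => ENNReal.ofReal (Real.exp (-((t * β i) * x))))
        (fun i => by fun_prop)]
    refine (mul_le_mul_right (Finset.prod_le_prod' fun i _ =>
      lintegral_exp_neg_mul_expMeasure_le (mul_nonneg ht0 (hβ i))) _).trans ?_
    rw [← ENNReal.ofReal_prod_of_nonneg (fun i _ => (Real.exp_pos _).le), ← Real.exp_sum,
        ← ENNReal.ofReal_mul (Real.exp_pos _).le, ← Real.exp_add]
    refine ENNReal.ofReal_le_ofReal (Real.exp_le_exp.2 (le_of_eq ?_))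
    have : ∑ i, (-(t * β i) + (t * β i) ^ 2 / 2) = -(t * S) + t ^ 2 / 2 * Q := by
      rw [hS, hQ, Finset.sum_add_distrib, Finset.mul_sum, Finset.mul_sum, ← Finset.sum_neg_distrib]
      congr 1
      exact Finset.sum_congr rfl fun i _ => by ring
    rw [this, ht]
    rcases eq_or_ne Q 0 with h | h
    · simp [h]
    · field_simp
      ring
  refine le_trans ?_ key
  rw [← lintegral_indicator_one (measurableSet_le (by fun_prop) measurable_const)]
  refine lintegral_mono (Set.indicator_le' (fun w hw => ?_) (fun _ _ => zero_le))
  simp only [Pi.one_apply, ENNReal.one_le_ofReal, Real.one_le_exp_iff]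
  exact mul_nonneg ht0 (sub_nonneg.2 hw)

/-! ### The law of a left endpoint -/

lemma lintegral_leftDensity_Ioc {r a b : ℝ} (hr : 0 < r) (ha : 0 ≤ a) (hab : a ≤ b) (hb : b ≤ r) :
    ∫⁻ x in Set.Ioc a b, leftDensity r x = ENNReal.ofReal ((√b - √a) / √r) := by
  have e : Set.EqOn (fun x => leftDensity r x)
      (fun x => ENNReal.ofReal ((1 / (2 * √r)) * x ^ (-(1 / 2) : ℝ))) (Set.Ioc a b) := by
    intro x hx
    have hx0 : 0 < x := ha.trans_lt hx.1
    simp only [leftDensity, hx0, hx.2.trans hb, and_self, if_true]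
    rw [Real.sqrt_mul hr.le, Real.rpow_neg hx0.le, ← Real.sqrt_eq_rpow]
    congr 1
    field_simp
  have hi : IntegrableOn (fun x => (1 / (2 * √r)) * x ^ (-(1 / 2) : ℝ)) (Set.Ioc a b) := by
    rw [← intervalIntegrable_iff_integrableOn_Ioc_of_le hab]
    exact (intervalIntegral.intervalIntegrable_rpow' (by norm_num)).const_mul _
  rw [setLIntegral_congr_fun measurableSet_Ioc e, ← ofReal_integral_eq_lintegral_ofReal hi]
  · rw [← intervalIntegral.integral_of_le hab, intervalIntegral.integral_const_mul,
      integral_rpow (Or.inl (by norm_num))]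
    have h2 : (-(1 / 2) + 1 : ℝ) = 1 / 2 := by norm_num
    rw [h2, ← Real.sqrt_eq_rpow, ← Real.sqrt_eq_rpow]
    have := Real.sqrt_pos.2 hr
    congr 1
    field_simp
  · filter_upwards [ae_restrict_mem measurableSet_Ioc] with x hx
    have hx0 : 0 < x := ha.trans_lt hx.1
    positivity

/-- The probability that a left endpoint avoids finitely many disjoint intervals. -/
lemma lintegral_leftDensity_compl_le {ι : Type*} {r : ℝ} (hr : 0 < r) (s : Finset ι) (a b : ι → ℝ)
    (ha : ∀ i ∈ s, 0 ≤ a i) (hab : ∀ i ∈ s, a i ≤ b i) (hb : ∀ i ∈ s, b i ≤ r)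
    (hd : (s : Set ι).PairwiseDisjoint fun i => Set.Ioc (a i) (b i)) :
    ∫⁻ x in (⋃ i ∈ s, Set.Ioc (a i) (b i))ᶜ, leftDensity r x ≤
      ENNReal.ofReal (Real.exp (-∑ i ∈ s, (√(b i) - √(a i)) / √r)) := by
  have hU : MeasurableSet (⋃ i ∈ s, Set.Ioc (a i) (b i)) :=
    Finset.measurableSet_biUnion _ fun i _ => measurableSet_Ioc
  have h1 : ∫⁻ x in ⋃ i ∈ s, Set.Ioc (a i) (b i), leftDensity r x =
      ENNReal.ofReal (∑ i ∈ s, (√(b i) - √(a i)) / √r) := by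
    rw [lintegral_biUnion_finset hd (fun i _ => measurableSet_Ioc), ENNReal.ofReal_sum_of_nonneg]
    · exact Finset.sum_congr rfl fun i hi =>
        lintegral_leftDensity_Ioc hr (ha i hi) (hab i hi) (hb i hi)
    · intro i hi
      exact div_nonneg (sub_nonneg.2 (Real.sqrt_le_sqrt (hab i hi))) (Real.sqrt_nonneg _)
  have h2 := lintegral_add_compl (fun x => leftDensity r x) hU (μ := volume)
  rw [lintegral_leftDensity hr, h1] at h2
  rw [ENNReal.eq_sub_of_add_eq' ENNReal.one_ne_top ((add_comm _ _).trans h2),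
    ← ENNReal.ofReal_one, ← ENNReal.ofReal_sub]
  · exact ENNReal.ofReal_le_ofReal (Real.one_sub_le_exp_neg _)
  · exact Finset.sum_nonneg fun i hi =>
      div_nonneg (sub_nonneg.2 (Real.sqrt_le_sqrt (hab i hi))) (Real.sqrt_nonneg _)

/-! ### Deterministic inequalities -/

/-- The Pólya–Szegő inequality against a constant sequence. -/
lemma card_mul_sum_sq_le {ι : Type*} (A : Finset ι) (x : ι → ℝ) {κ M : ℝ} (hM : 0 < M)
    (h1 : ∀ i ∈ A, κ * M ≤ x i) (h2 : ∀ i ∈ A, x i ≤ M) :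
    4 * κ * (A.card * ∑ i ∈ A, x i ^ 2) ≤ (1 + κ) ^ 2 * (∑ i ∈ A, x i) ^ 2 := by
  have h3 : ∑ i ∈ A, x i ^ 2 + A.card * (κ * M ^ 2) ≤ (1 + κ) * M * ∑ i ∈ A, x i := by
    rw [Finset.mul_sum, ← nsmul_eq_mul, ← Finset.sum_const, ← Finset.sum_add_distrib]
    refine Finset.sum_le_sum fun i hi => ?_
    nlinarith [mul_nonneg (sub_nonneg.2 (h1 i hi)) (sub_nonneg.2 (h2 i hi))]
  rcases le_or_gt κ 0 with hκ | hκ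
  · have : 0 ≤ (A.card : ℝ) * ∑ i ∈ A, x i ^ 2 :=
      mul_nonneg (Nat.cast_nonneg _) (Finset.sum_nonneg fun i _ => sq_nonneg _)
    have h4 : 0 ≤ (1 + κ) ^ 2 * (∑ i ∈ A, x i) ^ 2 := by positivity
    nlinarith
  have h0 : 0 ≤ ∑ i ∈ A, x i ^ 2 + A.card * (κ * M ^ 2) :=
    add_nonneg (Finset.sum_nonneg fun i _ => sq_nonneg _) (by positivity)
  have h5 := pow_le_pow_left₀ h0 h3 2
  have h6 := sq_nonneg (∑ i ∈ A, x i ^ 2 - A.card * (κ * M ^ 2))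
  have : M ^ 2 * (4 * κ * (A.card * ∑ i ∈ A, x i ^ 2)) ≤
      M ^ 2 * ((1 + κ) ^ 2 * (∑ i ∈ A, x i) ^ 2) := by nlinarith
  exact le_of_mul_le_mul_left this (by positivity)

/-- The sum of an antitone function over a set is at least its sum over a final segment of the
same size. -/
lemma sum_Ico_le_sum_of_antitone {n : ℕ} (ψ : ℕ → ℝ) (hψ : Antitone ψ) (A : Finset (Fin n)) :
    ∑ i ∈ Finset.Ico (n - A.card) n, ψ i ≤ ∑ i ∈ A, ψ i := by
  set T := Finset.Ico (n - A.card) n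
  set A' := A.map Fin.valEmbedding with hA'
  have hn : A.card ≤ n := by simpa using A.card_le_univ
  have hc : A'.card = T.card := by simp [A', T]; omega
  have hlt : ∀ i ∈ A', i < n := by
    intro i hi
    simp only [A', Finset.mem_map] at hi
    obtain ⟨j, _, rfl⟩ := hi
    exact j.2
  have hs : ∑ i ∈ A, ψ i = ∑ i ∈ A', ψ i := by simp [A']
  -- Off the common part, indices of `T` are at least `n - A.card` and those of `A'` are below it,
  -- so `ψ (n - A.card)` separates the two sums, which have equally many terms.
  rw [hs, ← Finset.sum_sdiff_le_sum_sdiff]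
  have hcd : (T \ A').card = (A' \ T).card := Finset.card_sdiff_comm hc.symm
  calc ∑ i ∈ T \ A', ψ i ≤ (T \ A').card • ψ (n - A.card) := by
        refine Finset.sum_le_card_nsmul _ _ _ fun i hi => hψ ?_
        exact (Finset.mem_Ico.1 (Finset.mem_sdiff.1 hi).1).1
    _ = (A' \ T).card • ψ (n - A.card) := by rw [hcd]
    _ ≤ ∑ i ∈ A' \ T, ψ i := by
        refine Finset.card_nsmul_le_sum _ _ _ fun i hi => hψ ?_
        have h1 := (Finset.mem_sdiff.1 hi)
        have h2 := hlt i h1.1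
        by_contra h3
        exact h1.2 (Finset.mem_Ico.2 ⟨by omega, h2⟩)

/-! ### Vertex weights and the lower bound `g`. -/

/-- The weight `1 / √(max (i, s))` of the vertex `i + 1`. -/
noncomputable def weight (s i : ℕ) : ℝ := 1 / √((max (i + 1) s : ℕ) : ℝ)

lemma weight_nonneg (s i : ℕ) : 0 ≤ weight s i := by unfold weight; positivity

lemma antitone_weight (s : ℕ) : Antitone (weight s) := by
  intro i j hij
  unfold weight
  refine one_div_le_one_div_of_le (Real.sqrt_pos.2 ?_) (Real.sqrt_le_sqrt ?_)
  · exact_mod_cast (by omega : 0 < max (i + 1) s)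
  · exact_mod_cast (by omega : max (i + 1) s ≤ max (j + 1) s)

lemma two_mul_sqrt_sub_le_weight {s i : ℕ} (hi : s ≤ i) :
    2 * (√((i : ℝ) + 2) - √((i : ℝ) + 1)) ≤ weight s i := by
  have h1 : ((max (i + 1) s : ℕ) : ℝ) = (i : ℝ) + 1 := by
    rw [max_eq_left (by omega)]; push_cast; ring
  rw [weight, h1]
  have hp : 0 < √((i : ℝ) + 1) := Real.sqrt_pos.2 (by positivity)
  have hle : √((i : ℝ) + 1) ≤ √((i : ℝ) + 2) := Real.sqrt_le_sqrt (by linarith)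
  have e1 := Real.sq_sqrt (show (0 : ℝ) ≤ (i : ℝ) + 1 by positivity)
  have e2 := Real.sq_sqrt (show (0 : ℝ) ≤ (i : ℝ) + 2 by positivity)
  rw [le_div_iff₀ hp]
  nlinarith

/-- The lightest set of this size is a final segment. It starts at or after `s`, where the
truncation in `weight` is inactive, so the square-root differences telescope; the shift to `n + 1`
arises here. -/
lemma two_mul_sqrt_sub_le_sum_weight {n s : ℕ} (A : Finset (Fin n)) (hA : A.card + s ≤ n) :
    2 * (√((n : ℝ) + 1) - √((n : ℝ) + 1 - A.card)) ≤ ∑ i ∈ A, weight s i := by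
  refine le_trans ?_ (sum_Ico_le_sum_of_antitone _ (antitone_weight s) A)
  refine le_trans (le_of_eq ?_) (Finset.sum_le_sum fun i hi =>
    two_mul_sqrt_sub_le_weight (s := s) (by have := (Finset.mem_Ico.1 hi).1; omega))
  have h := Finset.sum_Ico_sub (fun i : ℕ => √((i : ℝ) + 1)) (show n - A.card ≤ n by omega)
  rw [← Finset.mul_sum]
  congr 1
  push_cast [show A.card ≤ n by omega] at h
  rw [show (n : ℝ) + 1 - A.card = n - A.card + 1 by ring, ← h]
  refine Finset.sum_congr rfl fun i _ => ?_
  rw [show (i : ℝ) + 1 + 1 = i + 2 by ring]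

/-- The concave function `x ↦ x * (T - x)` is minimized on `[p, T - q]` at an endpoint; beyond `T -
q`, the bound `q ≤ y` suffices directly. -/
lemma min_le_mul_of_le {p q T x y : ℝ} (hq : 0 ≤ q) (hp0 : 0 ≤ p)
    (hp : p ≤ x) (hqy : q ≤ y) (hT : T ≤ x + y) :
    min (p * (T - p)) (q * (T - q)) ≤ x * y := by
  have hx : 0 ≤ x := hp0.trans hp
  have hy : 0 ≤ y := hq.trans hqy
  rcases le_total (T - q) x with hx1 | hx1
  · refine (min_le_right _ _).trans ?_
    calc q * (T - q) ≤ q * x := mul_le_mul_of_nonneg_left hx1 hq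
      _ ≤ y * x := mul_le_mul_of_nonneg_right hqy hx
      _ = x * y := mul_comm _ _
  · have h1 : x * (T - x) ≤ x * y := mul_le_mul_of_nonneg_left (by linarith) hx
    refine le_trans ?_ h1
    rcases le_total (x + p) T with h2 | h2
    · refine (min_le_left _ _).trans ?_
      nlinarith [mul_nonneg (sub_nonneg.2 hp) (sub_nonneg.2 h2)]
    · refine (min_le_right _ _).trans ?_
      nlinarith [mul_nonneg (sub_nonneg.2 hx1) (show 0 ≤ x - q by linarith)]

lemma g_le_sum_weight_mul_sum_weight {n s : ℕ} {A B : Finset (Fin n)} (hAB : Disjoint A B)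
    (hs : A.card + B.card + s = n) :
    g n A.card B.card ≤ (∑ i ∈ A, weight s i) * ∑ i ∈ B, weight s i := by
  have hT := two_mul_sqrt_sub_le_sum_weight (s := s) (A ∪ B)
    (by rw [Finset.card_union_of_disjoint hAB]; omega)
  rw [Finset.sum_union hAB, Finset.card_union_of_disjoint hAB] at hT
  push_cast at hT
  have hA := two_mul_sqrt_sub_le_sum_weight (s := s) A (by omega)
  have hB := two_mul_sqrt_sub_le_sum_weight (s := s) B (by omega)
  have h0 : ∀ a : ℕ, 0 ≤ 2 * (√((n : ℝ) + 1) - √((n : ℝ) + 1 - a)) := fun a =>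
    mul_nonneg zero_le_two (sub_nonneg.2 (Real.sqrt_le_sqrt (by
      have : (0 : ℝ) ≤ a := Nat.cast_nonneg a
      linarith)))
  -- With `T` the bound for `A ∪ B` and `q` the one for `B`, the product `q * (T - q)` is exactly `h
  -- n A.card B.card`; exchanging `A` and `B` gives the other term.
  refine le_trans (le_of_eq ?_) (min_le_mul_of_le (h0 B.card) (h0 A.card) hA hB hT)
  rw [g, min_comm, h, h]
  congr 1 <;> ring_nf

/-! ### First and second moments of the slopes. -/

/-- The exponent contributed by the vertex `i` joined to later vertices of `O i`. -/
noncomputable def slope {n : ℕ} (s : ℕ) (O : Fin n → Finset (Fin n)) (i : Fin n) : ℝ :=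
  weight s i * ∑ j ∈ O i with i < j, weight s j

/-- The set opposite to the vertex `i` in the pair `(A, B)`. -/
def opposite {n : ℕ} (A B : Finset (Fin n)) (i : Fin n) : Finset (Fin n) :=
  if i ∈ A then B else if i ∈ B then A else ∅

section
variable {n s : ℕ} {A B : Finset (Fin n)}

lemma slope_nonneg (O : Fin n → Finset (Fin n)) (i : Fin n) : 0 ≤ slope s O i :=
  mul_nonneg (weight_nonneg _ _) (Finset.sum_nonneg fun _ _ => weight_nonneg _ _)

lemma opposite_of_mem_left {i : Fin n} (hi : i ∈ A) : opposite A B i = B := by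
  simp [opposite, hi]

lemma opposite_of_mem_right (hAB : Disjoint A B) {i : Fin n} (hi : i ∈ B) :
    opposite A B i = A := by
  simp [opposite, hi, Finset.disjoint_right.1 hAB hi]

lemma sum_opposite_eq (hAB : Disjoint A B) (F : Fin n → Finset (Fin n) → ℝ) (hF : ∀ i, F i ∅ = 0) :
    ∑ i, F i (opposite A B i) = ∑ i ∈ A, F i B + ∑ i ∈ B, F i A := by
  have hl : ∑ i ∈ A, F i B = ∑ i ∈ A, F i (opposite A B i) :=
    Finset.sum_congr rfl fun i hi => by rw [opposite_of_mem_left hi]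
  have hr : ∑ i ∈ B, F i A = ∑ i ∈ B, F i (opposite A B i) :=
    Finset.sum_congr rfl fun i hi => by rw [opposite_of_mem_right hAB hi]
  rw [hl, hr, ← Finset.sum_union hAB]
  refine (Finset.sum_subset (Finset.subset_univ _) fun i _ hi => ?_).symm
  rw [Finset.mem_union, not_or] at hi
  simp [opposite, hi.1, hi.2, hF]

/-- Each pair in `A × B` is counted exactly once, at its smaller vertex. -/
lemma sum_slope_opposite (hAB : Disjoint A B) :
    ∑ i, slope s (opposite A B) i = (∑ i ∈ A, weight s i) * ∑ i ∈ B, weight s i := by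
  have h := sum_opposite_eq hAB (fun i O => weight s i * ∑ j ∈ O with i < j, weight s j) (by simp)
  refine h.trans ?_
  simp only [Finset.mul_sum, Finset.sum_mul, Finset.sum_filter]
  rw [Finset.sum_comm (s := B), Finset.sum_comm (s := B), ← Finset.sum_add_distrib]
  refine Finset.sum_congr rfl fun i hi => ?_
  rw [← Finset.sum_add_distrib]
  refine Finset.sum_congr rfl fun j hj => ?_
  have hne : i ≠ j := fun e => Finset.disjoint_left.1 hAB hi (e ▸ hj)
  rcases lt_or_gt_of_ne hne with h | h
  · simp [h, h.not_gt]
  · simp [h, h.not_gt, mul_comm]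

/-- Dropping the restriction `i < j` only enlarges the inner sums. -/
lemma sum_slope_sq_le (hAB : Disjoint A B) :
    ∑ i, slope s (opposite A B) i ^ 2 ≤
      (∑ i ∈ A, weight s i ^ 2) * (∑ i ∈ B, weight s i) ^ 2 +
        (∑ i ∈ B, weight s i ^ 2) * (∑ i ∈ A, weight s i) ^ 2 := by
  have h := sum_opposite_eq hAB (fun i O => (weight s i * ∑ j ∈ O with i < j, weight s j) ^ 2)
    (by simp)
  refine h.le.trans ?_
  simp only [mul_pow, Finset.sum_mul]
  gcongr with i _ i _
  all_goals
    first
    | exact Finset.sum_nonneg fun _ _ => weight_nonneg _ _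
    | exact fun _ _ _ => weight_nonneg _ _
    | exact Finset.filter_subset _ _

/-- The comparison of the first and second moments of the slopes. -/
lemma mul_div_mul_sum_slope_sq_le (hAB : Disjoint A B) (hA : A.Nonempty) (hB : B.Nonempty)
    {δ : ℝ} (hδ : δ ∈ Set.Ioo (0 : ℝ) 1) (hs : (s : ℝ) = δ * n) :
    4 * √δ / (1 + √δ) ^ 2 * ((A.card : ℝ) * B.card / ((A.card : ℝ) + B.card)) *
        ∑ i, slope s (opposite A B) i ^ 2 ≤ (∑ i, slope s (opposite A B) i) ^ 2 := by
  have hn : 0 < n := by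
    obtain ⟨i, _⟩ := hA
    exact i.pos
  have hn' : (0 : ℝ) < n := by exact_mod_cast hn
  have hs0 : (0 : ℝ) < s := by rw [hs]; exact mul_pos hδ.1 hn'
  have hsn : (s : ℝ) ≤ n := by rw [hs]; nlinarith [hδ.2]
  have hδ0 := Real.sqrt_pos.2 hδ.1
  -- All weights lie in `[1 / √n, 1 / √s]`, whose endpoints have ratio `√δ` because `s = δ n`:
  -- Pólya–Szegő applies with `κ = √δ`.
  have hw1 : ∀ i : Fin n, weight s i ≤ 1 / √(s : ℝ) := fun i =>
    one_div_le_one_div_of_le (Real.sqrt_pos.2 hs0)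
      (Real.sqrt_le_sqrt (by exact_mod_cast le_max_right _ _))
  have hw2 : ∀ i : Fin n, √δ * (1 / √(s : ℝ)) ≤ weight s i := fun i => by
    have h1 : √δ * (1 / √(s : ℝ)) = 1 / √(n : ℝ) := by
      rw [hs, Real.sqrt_mul hδ.1.le]
      field_simp
    rw [h1]
    refine one_div_le_one_div_of_le (Real.sqrt_pos.2 ?_) (Real.sqrt_le_sqrt ?_)
    · exact_mod_cast (by omega : 0 < max ((i : ℕ) + 1) s)
    · have h2 : s ≤ n := by exact_mod_cast hsn
      exact_mod_cast (by have := i.2; omega : max ((i : ℕ) + 1) s ≤ n)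
  have pA := card_mul_sum_sq_le A (fun i => weight s i) (by positivity) (fun i _ => hw2 i)
    (fun i _ => hw1 i)
  have pB := card_mul_sum_sq_le B (fun i => weight s i) (by positivity) (fun i _ => hw2 i)
    (fun i _ => hw1 i)
  have ha : (0 : ℝ) < A.card := by exact_mod_cast hA.card_pos
  have hb : (0 : ℝ) < B.card := by exact_mod_cast hB.card_pos
  have hsq := sum_slope_sq_le (s := s) hAB
  rw [sum_slope_opposite hAB]
  set a : ℝ := (A.card : ℝ)
  set b : ℝ := (B.card : ℝ)
  set FA := ∑ i ∈ A, weight s i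
  set FB := ∑ i ∈ B, weight s i
  set QA := ∑ i ∈ A, weight s i ^ 2
  set QB := ∑ i ∈ B, weight s i ^ 2
  have e : 4 * √δ / (1 + √δ) ^ 2 * (a * b / (a + b)) = 4 * √δ * (a * b) / ((1 + √δ) ^ 2 * (a + b)) := by
    field_simp
  rw [e, div_mul_eq_mul_div, div_le_iff₀ (by positivity)]
  calc 4 * √δ * (a * b) * ∑ i, slope s (opposite A B) i ^ 2
      ≤ 4 * √δ * (a * b) * (QA * FB ^ 2 + QB * FA ^ 2) := by gcongr
    _ = b * FB ^ 2 * (4 * √δ * (a * QA)) + a * FA ^ 2 * (4 * √δ * (b * QB)) := by ring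
    _ ≤ b * FB ^ 2 * ((1 + √δ) ^ 2 * FA ^ 2) + a * FA ^ 2 * ((1 + √δ) ^ 2 * FB ^ 2) := by gcongr
    _ = (FA * FB) ^ 2 * ((1 + √δ) ^ 2 * (a + b)) := by ring

end

/-! ### The event that two vertex sets are separated -/

lemma W_succ {M : ℕ} (w : Fin M → ℝ) {j : ℕ} (hj : j < M) : W w (j + 1) = W w j + w ⟨j, hj⟩ := by
  unfold W
  have : (Finset.univ.filter fun i : Fin M => i.val < j + 1) =
      insert ⟨j, hj⟩ (Finset.univ.filter fun i : Fin M => i.val < j) := by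
    ext i
    simp only [Finset.mem_filter, Finset.mem_univ, true_and, Finset.mem_insert, Fin.ext_iff]
    omega
  rw [this, Finset.sum_insert (by simp), add_comm]

lemma W_mono {M : ℕ} {w : Fin M → ℝ} (hw : ∀ i, 0 < w i) : Monotone (W w) := by
  intro i j hij
  refine Finset.sum_le_sum_of_subset_of_nonneg (fun a ha => ?_) fun a _ _ => (hw a).le
  simp only [Finset.mem_filter, Finset.mem_univ, true_and] at ha ⊢
  omega

lemma W_nonneg {M : ℕ} {w : Fin M → ℝ} (hw : ∀ i, 0 < w i) (j : ℕ) : 0 ≤ W w j :=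
  Finset.sum_nonneg fun i _ => (hw i).le

lemma R_nonneg {N : ℕ} {w : Fin (N + 1) → ℝ} (hw : ∀ i, 0 < w i) (j : ℕ) : 0 ≤ R w j :=
  div_nonneg (W_nonneg hw _) (W_nonneg hw _)

lemma R_mono {N : ℕ} {w : Fin (N + 1) → ℝ} (hw : ∀ i, 0 < w i) : Monotone (R w) := fun _ _ hij =>
  div_le_div_of_nonneg_right (W_mono hw hij) (W_nonneg hw _)

lemma measurable_R {N : ℕ} (j : ℕ) : Measurable fun w : Fin (N + 1) → ℝ => R w j :=
  (measurable_W _).div (measurable_W _)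

lemma leftEndIn_unique {N : ℕ} {w : Fin (N + 1) → ℝ} (hw : ∀ i, 0 < w i) {l : Fin N → ℝ}
    {k u v : Fin N} (hu : LeftEndIn w l k u) (hv : LeftEndIn w l k v) : v = u := by
  by_contra hne
  rcases lt_or_gt_of_ne hne with h | h
  · exact absurd (hv.2.trans (R_mono hw (show (v : ℕ) + 1 ≤ u from h))) hu.1.not_ge
  · exact absurd (hu.2.trans (R_mono hw (show (u : ℕ) + 1 ≤ v from h))) hv.1.not_ge

/-- The chords `u` whose vertex precedes that of `k` and is opposite to it. -/
def crossing {n m : ℕ} (A B : Finset (Fin n)) (k : Fin (n * m)) : Finset (Fin (n * m)) :=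
  {u | u.divNat < k.divNat ∧ k.divNat ∈ opposite A B u.divNat}

lemma lt_of_divNat_lt {n m : ℕ} {u k : Fin (n * m)} (h : u.divNat < k.divNat) : u < k := by
  by_contra h'
  exact absurd (Nat.div_le_div_right (c := m) (not_lt.1 h')) (not_le.2 h)

/-- Positivity of `w` makes the intervals disjoint, so a left endpoint in the interval of `u` meets
the uniqueness clause of `graph` and creates an edge between `A` and `B`. -/
lemma not_leftEndIn_of_not_adj {n m : ℕ} {w : Fin (n * m + 1) → ℝ} (hw : ∀ i, 0 < w i)
    {l : Fin (n * m) → ℝ} {A B : Finset (Fin n)} (hAB : Disjoint A B)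
    (h : ∀ a ∈ A, ∀ b ∈ B, ¬ (graph w l).Adj a b) {k u : Fin (n * m)} (hu : u ∈ crossing A B k) :
    ¬ LeftEndIn w l k u := by
  intro hL
  have hlink : (graph w l).Adj u.divNat k.divNat :=
    ⟨k, u, fun v => ⟨fun hv => leftEndIn_unique hw hL hv, fun e => e ▸ hL⟩, rfl⟩
  have h2 : k.divNat ∈ opposite A B u.divNat := (Finset.mem_filter.1 hu).2.2
  by_cases hA : u.divNat ∈ A
  · rw [opposite_of_mem_left hA] at h2
    exact h _ hA _ h2 hlink
  by_cases hB : u.divNat ∈ B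
  · rw [opposite_of_mem_right hAB hB] at h2
    exact h _ h2 _ hB hlink.symm
  · simp [opposite, hA, hB] at h2

lemma law_forall_notMem_le {N : ℕ} {E : Set (Fin (N + 1) → ℝ)} (hE : MeasurableSet E)
    (C : Fin N → Finset (Fin N)) (hC : ∀ k, ∀ u ∈ C k, u < k) :
    law N {x | x.1 ∈ E ∧ ∀ k, ∀ u ∈ C k, ¬ LeftEndIn x.1 x.2 k u} ≤
      ∫⁻ w in E, ENNReal.ofReal (Real.exp
        (-∑ k, ∑ u ∈ C k, (√(R w ((u : ℕ) + 1)) - √(R w u)) / √(R w ((k : ℕ) + 1))))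
        ∂(Measure.pi fun _ : Fin (N + 1) => ProbabilityTheory.expMeasure 1) := by
  have := ProbabilityTheory.isProbabilityMeasure_expMeasure one_pos
  set S : Set ((Fin (N + 1) → ℝ) × (Fin N → ℝ)) :=
    {x | x.1 ∈ E ∧ ∀ k, ∀ u ∈ C k, ¬ LeftEndIn x.1 x.2 k u} with hSdef
  have hS : MeasurableSet S := by
    have hl : ∀ k u : Fin N, MeasurableSet {x : (Fin (N + 1) → ℝ) × (Fin N → ℝ) |
        LeftEndIn x.1 x.2 k u} := fun k u =>
      (measurableSet_lt ((measurable_R _).comp measurable_fst) (by fun_prop)).inter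
        (measurableSet_le (by fun_prop) ((measurable_R _).comp measurable_fst))
    have e : S = Prod.fst ⁻¹' E ∩ ⋂ k, ⋂ u ∈ C k, {x | LeftEndIn x.1 x.2 k u}ᶜ := by
      ext x
      simp [S]
    rw [e]
    exact (measurable_fst hE).inter (MeasurableSet.iInter fun k => MeasurableSet.iInter fun u =>
      MeasurableSet.iInter fun _ => (hl k u).compl)
  have hm : Measurable fun x : (Fin (N + 1) → ℝ) × (Fin N → ℝ) =>
      ∏ k : Fin N, leftDensity (R x.1 ((k : ℕ) + 1)) (x.2 k) := by
    refine Finset.measurable_prod _ fun k _ => measurable_leftDensity.comp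
      (Measurable.prodMk ((measurable_R _).comp measurable_fst) ?_)
    fun_prop
  rw [law, withDensity_apply _ hS, ← lintegral_indicator hS,
    lintegral_prod _ (hm.indicator hS).aemeasurable, ← lintegral_indicator hE]
  refine lintegral_mono_ae ?_
  filter_upwards [ae_exp_pos (N + 1)] with w hw
  by_cases hwE : w ∈ E
  swap
  · have : ∀ l : Fin N → ℝ, (w, l) ∉ S := fun l hl => hwE hl.1
    simp [this]
  rw [Set.indicator_of_mem hwE]
  let U : Fin N → Set ℝ := fun k => ⋃ u ∈ C k, Set.Ioc (R w u) (R w ((u : ℕ) + 1))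
  have hU : ∀ k, MeasurableSet (U k) := fun k =>
    Finset.measurableSet_biUnion _ fun i _ => measurableSet_Ioc
  have hld : ∀ r, Measurable fun x => leftDensity r x := fun r =>
    measurable_leftDensity.comp (measurable_const.prodMk measurable_id)
  have hpt : ∀ l : Fin N → ℝ, S.indicator
      (fun x => ∏ k : Fin N, leftDensity (R x.1 ((k : ℕ) + 1)) (x.2 k)) (w, l) ≤
      ∏ k, (U k)ᶜ.indicator (fun x => leftDensity (R w ((k : ℕ) + 1)) x) (l k) := by
    intro l
    by_cases hl : (w, l) ∈ S
    · rw [Set.indicator_of_mem hl]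
      refine le_of_eq (Finset.prod_congr rfl fun k _ => ?_)
      rw [Set.indicator_of_mem]
      simp only [U, Set.mem_compl_iff, Set.mem_iUnion, not_exists]
      exact fun u hu => hl.2 k u hu
    · simp [Set.indicator_of_notMem hl]
  refine (lintegral_mono hpt).trans ?_
  rw [lintegral_prod_coord _ fun k => (hld _).indicator (hU k).compl, ← Finset.sum_neg_distrib,
    Real.exp_sum, ENNReal.ofReal_prod_of_nonneg fun _ _ => (Real.exp_pos _).le]
  refine Finset.prod_le_prod' fun k _ => ?_
  rw [lintegral_indicator (hU k).compl]
  refine lintegral_leftDensity_compl_le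
    (div_pos (W_pos hw (by omega) (by omega)) (W_pos hw (by omega) le_rfl)) _ _ _
    -- `u < k` places the whole interval of `u` inside the support of the density of the left
    -- endpoint of `k`.
    (fun u _ => R_nonneg hw _) (fun u _ => R_mono hw (Nat.le_succ _)) (fun u hu => R_mono hw ?_) ?_
  · have := hC k u hu
    omega
  · intro u _ v _ huv
    refine Set.disjoint_left.2 fun x hx hx' => huv ?_
    exact (leftEndIn_unique (l := fun _ => x) (k := k) hw hx hx').symm

/-! ### Linear lower bound for the exponent on `𝒲`. -/

lemma sum_divNat {n m : ℕ} (F : Fin n → ℝ) : ∑ k : Fin (n * m), F k.divNat = m * ∑ i, F i := by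
  have h := finProdFinEquiv.symm.sum_comp fun p : Fin n × Fin m => F p.1
  refine h.trans ?_
  simp [Fintype.sum_prod_type, Finset.mul_sum]

/-- The bound on `W_j / j` in the event `𝒲`. -/
noncomputable def growth (n : ℕ) : ℝ := 1 + (n : ℝ) ^ (-(1 / 2) : ℝ) * Real.log n

lemma growth_pos (n : ℕ) : 0 < growth n := by
  unfold growth
  have := Real.log_natCast_nonneg n
  positivity

lemma tendsto_growth : Tendsto growth atTop (𝓝 1) := by
  have h : Tendsto (fun x : ℝ => Real.log x / x ^ (1 / 2 : ℝ)) atTop (𝓝 0) :=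
    (isLittleO_log_rpow_atTop (by norm_num)).tendsto_div_nhds_zero
  have h2 := (h.comp tendsto_natCast_atTop_atTop).const_add 1
  rw [add_zero] at h2
  refine h2.congr fun n => ?_
  simp only [growth, Function.comp]
  rw [Real.rpow_neg (Nat.cast_nonneg n), div_eq_mul_inv, mul_comm]

section
variable {n m s : ℕ} {δ : ℝ} {w : Fin (n * m + 1) → ℝ}

lemma W_le_of_eventW (hw : ∀ i, 0 < w i) (hs : (s : ℝ) = δ * n) (hsn : s ≤ n) (hm : 0 < m)
    (hE : EventW n m δ w) (u : Fin (n * m)) :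
    W w ((u : ℕ) + 1) ≤ m * growth n * (max ((u.divNat : ℕ) + 1) s : ℕ) := by
  set j := max ((u.divNat : ℕ) + 1) s with hj
  have hj0 : 0 < j := by omega
  have h1 := hE j (by rw [← hs]; exact_mod_cast le_max_right _ _)
    (by have := u.divNat.2; omega)
  have hmj : (0 : ℝ) < m * j := by exact_mod_cast Nat.mul_pos hm hj0
  rw [div_le_iff₀ hmj] at h1
  refine (W_mono hw ?_).trans (h1.trans (le_of_eq ?_))
  · have h2 : (u : ℕ) < m * ((u.divNat : ℕ) + 1) := Nat.lt_mul_div_succ _ hm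
    exact Nat.succ_le_of_lt (h2.trans_le (Nat.mul_le_mul_left m (le_max_left _ _)))
  · rw [growth]; ring

lemma le_sqrt_R_sub_div (hw : ∀ i, 0 < w i) (hs : (s : ℝ) = δ * n) (hsn : s ≤ n) (hm : 0 < m)
    (hE : EventW n m δ w) (u k : Fin (n * m)) :
    1 / (2 * growth n) / m * (weight s u.divNat * weight s k.divNat) * w u.castSucc ≤
      (√(R w ((u : ℕ) + 1)) - √(R w u)) / √(R w ((k : ℕ) + 1)) := by
  have hT : 0 < W w (n * m + 1) := W_pos hw (by omega) le_rfl
  have hu : 0 < W w ((u : ℕ) + 1) := W_pos hw (by omega) (by omega)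
  have hk : 0 < W w ((k : ℕ) + 1) := W_pos hw (by omega) (by omega)
  -- The normalization by the total sum cancels, so no control of it is needed.
  have e1 : (√(R w ((u : ℕ) + 1)) - √(R w u)) / √(R w ((k : ℕ) + 1)) =
      (√(W w ((u : ℕ) + 1)) - √(W w u)) / √(W w ((k : ℕ) + 1)) := by
    simp only [R]
    rw [Real.sqrt_div' _ hT.le, Real.sqrt_div' _ hT.le, Real.sqrt_div' _ hT.le]
    have := Real.sqrt_pos.2 hT
    have := Real.sqrt_pos.2 hk
    field_simp
  have hbu := Real.sqrt_le_sqrt (W_le_of_eventW hw hs hsn hm hE u)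
  have hbk := Real.sqrt_le_sqrt (W_le_of_eventW hw hs hsn hm hE k)
  have hm' : (0 : ℝ) < m := by exact_mod_cast hm
  have hmg : (0 : ℝ) < m * growth n := mul_pos hm' (growth_pos n)
  rw [Real.sqrt_mul hmg.le] at hbu hbk
  have hpu := Real.sqrt_pos.2 hu
  have hpk := Real.sqrt_pos.2 hk
  have e2 : w u.castSucc = W w ((u : ℕ) + 1) - W w u := by
    rw [W_succ w (show (u : ℕ) < n * m + 1 by omega)]
    simp only [add_sub_cancel_left]
    rfl
  -- This is `√x - √y = (x - y) / (√x + √y)` with `√y ≤ √x`.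
  have e3 : w u.castSucc / (2 * √(W w ((u : ℕ) + 1))) ≤ √(W w ((u : ℕ) + 1)) - √(W w u) := by
    rw [e2, div_le_iff₀ (by positivity)]
    nlinarith [Real.sq_sqrt hu.le, Real.sq_sqrt (W_nonneg hw (u : ℕ)),
      sq_nonneg (√(W w ((u : ℕ) + 1)) - √(W w u))]
  rw [e1]
  refine le_trans ?_ (div_le_div_of_nonneg_right e3 hpk.le)
  have hju : (0 : ℝ) < (max ((u.divNat : ℕ) + 1) s : ℕ) := by
    exact_mod_cast (by omega : 0 < max ((u.divNat : ℕ) + 1) s)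
  have hjk : (0 : ℝ) < (max ((k.divNat : ℕ) + 1) s : ℕ) := by
    exact_mod_cast (by omega : 0 < max ((k.divNat : ℕ) + 1) s)
  have hsu := Real.sqrt_pos.2 hju
  have hsk := Real.sqrt_pos.2 hjk
  have hg := growth_pos n
  have hww := hw u.castSucc
  unfold weight
  set X := √((max ((u.divNat : ℕ) + 1) s : ℕ) : ℝ)
  set Y := √((max ((k.divNat : ℕ) + 1) s : ℕ) : ℝ)
  calc 1 / (2 * growth n) / m * (1 / X * (1 / Y)) * w u.castSucc
      = w u.castSucc / (2 * (√(m * growth n) * X) * (√(m * growth n) * Y)) := by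
        have := Real.mul_self_sqrt hmg.le
        rw [show 2 * (√(m * growth n) * X) * (√(m * growth n) * Y) =
          2 * (√(m * growth n) * √(m * growth n)) * X * Y by ring, this]
        field_simp
    _ ≤ w u.castSucc / (2 * √(W w ((u : ℕ) + 1)) * √(W w ((k : ℕ) + 1))) := by
        gcongr
    _ = _ := by rw [div_div]

lemma le_sum_crossing (hw : ∀ i, 0 < w i) (hs : (s : ℝ) = δ * n) (hsn : s ≤ n) (hm : 0 < m)
    (hE : EventW n m δ w) (A B : Finset (Fin n)) :
    1 / (2 * growth n) *
        ∑ u : Fin (n * m), slope s (opposite A B) u.divNat * w u.castSucc ≤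
      ∑ k : Fin (n * m), ∑ u ∈ crossing A B k,
        (√(R w ((u : ℕ) + 1)) - √(R w u)) / √(R w ((k : ℕ) + 1)) := by
  refine le_trans (le_of_eq ?_) (Finset.sum_le_sum fun k _ => Finset.sum_le_sum fun u _ =>
    le_sqrt_R_sub_div hw hs hsn hm hE u k)
  have hm' : (m : ℝ) ≠ 0 := by exact_mod_cast hm.ne'
  simp only [crossing, Finset.sum_filter]
  rw [Finset.sum_comm, Finset.mul_sum]
  refine Finset.sum_congr rfl fun u _ => ?_
  -- The `m` chords `k` ending at each vertex absorb the factor `1 / m` of the termwise bound.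
  have h := sum_divNat (m := m) fun j : Fin n =>
    if u.divNat < j ∧ j ∈ opposite A B u.divNat then
      1 / (2 * growth n) / m * (weight s u.divNat * weight s j) * w u.castSucc else 0
  rw [h, slope, ← Finset.sum_filter, ← Finset.sum_mul, ← Finset.mul_sum, ← Finset.mul_sum]
  have e : (Finset.univ.filter fun j => u.divNat < j ∧ j ∈ opposite A B u.divNat) =
      (opposite A B u.divNat).filter fun j => u.divNat < j := by
    ext j
    simp [and_comm]
  rw [e]
  field_simp

end

/-! ### Probability bound for one pair, and the union bound. -/

lemma ae_law_pos (N : ℕ) : ∀ᵐ x ∂(law N), ∀ i, 0 < x.1 i := by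
  have := ProbabilityTheory.isProbabilityMeasure_expMeasure one_pos
  exact (withDensity_absolutelyContinuous _ _).ae_le
    (Measure.quasiMeasurePreserving_fst.ae (ae_exp_pos (N + 1)))

lemma measurableSet_eventW (n m : ℕ) (δ : ℝ) : MeasurableSet {w | EventW n m δ w} := by
  unfold EventW
  simp only [Set.ofPred_forall]
  exact MeasurableSet.iInter fun j => MeasurableSet.iInter fun _ => MeasurableSet.iInter fun _ =>
    measurableSet_le ((measurable_W _).div_const _) measurable_const

lemma weight_pos (s i : ℕ) : 0 < weight s i := by
  have : (0 : ℝ) < (max (i + 1) s : ℕ) := by exact_mod_cast (by omega : 0 < max (i + 1) s)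
  unfold weight
  positivity

/-- The lower tail of the exponent attached to the pair `(A, B)`. -/
lemma measure_sum_slope_le {n m s : ℕ} (O : Fin n → Finset (Fin n)) {ε : ℝ} (hε : 0 ≤ ε) :
    (Measure.pi fun _ : Fin (n * m + 1) => ProbabilityTheory.expMeasure 1)
        {w | ∑ u : Fin (n * m), slope s O u.divNat * w u.castSucc ≤
          (1 - ε) * (m * ∑ i, slope s O i)} ≤
      ENNReal.ofReal (Real.exp
        (-(ε ^ 2 * (m * ∑ i, slope s O i) ^ 2 / (2 * (m * ∑ i, slope s O i ^ 2))))) := by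
  -- The last variable `w_{nm+1}` belongs to no chord and receives coefficient `0`.
  have h := measure_sum_mul_le_exp
    (Fin.snoc (α := fun _ => ℝ) (fun u : Fin (n * m) => slope s O u.divNat) 0)
    (fun i => by
      refine Fin.lastCases ?_ (fun u => ?_) i
      · simp
      · simpa using slope_nonneg _ _) hε
  simp only [Fin.sum_univ_castSucc, Fin.snoc_castSucc, Fin.snoc_last, zero_mul, add_zero] at h
  rwa [sum_divNat, zero_pow two_ne_zero, add_zero, sum_divNat (fun i => slope s O i ^ 2)] at h

lemma lintegral_eventW_exp_neg_le {n m s : ℕ} {δ ε : ℝ} (hs : (s : ℝ) = δ * n) (hsn : s ≤ n)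
    (hm : 0 < m) (hε : 0 ≤ ε) (A B : Finset (Fin n)) :
    ∫⁻ w in {w | EventW n m δ w}, ENNReal.ofReal (Real.exp
        (-∑ k : Fin (n * m), ∑ u ∈ crossing A B k,
          (√(R w ((u : ℕ) + 1)) - √(R w u)) / √(R w ((k : ℕ) + 1))))
        ∂(Measure.pi fun _ : Fin (n * m + 1) => ProbabilityTheory.expMeasure 1) ≤
      ENNReal.ofReal (Real.exp (-(1 / (2 * growth n) *
          ((1 - ε) * (m * ∑ i, slope s (opposite A B) i))))) +
        ENNReal.ofReal (Real.exp (-(ε ^ 2 * (m * ∑ i, slope s (opposite A B) i) ^ 2 /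
          (2 * (m * ∑ i, slope s (opposite A B) i ^ 2))))) := by
  have := ProbabilityTheory.isProbabilityMeasure_expMeasure one_pos
  set P := Measure.pi fun _ : Fin (n * m + 1) => ProbabilityTheory.expMeasure 1
  set y := (1 - ε) * (m * ∑ i, slope s (opposite A B) i)
  set Z : Set (Fin (n * m + 1) → ℝ) :=
    {w | ∑ u : Fin (n * m), slope s (opposite A B) u.divNat * w u.castSucc ≤ y} with hZ
  have hZm : MeasurableSet Z := measurableSet_le (by fun_prop) measurable_const
  have hc : 0 < 1 / (2 * growth n) := by have := growth_pos n; positivity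
  have hmono : ∀ᵐ w ∂(P.restrict {w | EventW n m δ w}),
      ENNReal.ofReal (Real.exp (-∑ k : Fin (n * m), ∑ u ∈ crossing A B k,
          (√(R w ((u : ℕ) + 1)) - √(R w u)) / √(R w ((k : ℕ) + 1)))) ≤
        ENNReal.ofReal (Real.exp (-(1 / (2 * growth n) * y))) + Z.indicator 1 w := by
    filter_upwards [ae_restrict_of_ae (ae_exp_pos (n * m + 1)),
      ae_restrict_mem (measurableSet_eventW n m δ)] with w hw hE
    have hX := le_sum_crossing hw hs hsn hm hE A B
    -- On the lower-tail event the exponential is only bounded by `1`; off it, the linear form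
    -- exceeds `y`.
    by_cases hwZ : w ∈ Z
    · rw [Set.indicator_of_mem hwZ]
      refine le_trans ?_ le_add_self
      rw [Pi.one_apply, ENNReal.ofReal_le_one, Real.exp_le_one_iff, neg_nonpos]
      exact le_trans (mul_nonneg hc.le (Finset.sum_nonneg fun u _ =>
        mul_nonneg (slope_nonneg _ _) (hw _).le)) hX
    · refine le_trans ?_ le_self_add
      refine ENNReal.ofReal_le_ofReal (Real.exp_le_exp.2 (neg_le_neg (le_trans ?_ hX)))
      exact mul_le_mul_of_nonneg_left (not_le.1 hwZ).le hc.le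
  refine (lintegral_mono_ae hmono).trans ((setLIntegral_le_lintegral _ _).trans ?_)
  rw [lintegral_add_left measurable_const, lintegral_const, measure_univ, mul_one,
    lintegral_indicator_one hZm]
  exact add_le_add_right (measure_sum_slope_le _ hε) _

/-- The bound for a single pair of vertex sets. -/
lemma law_separated_le {n m s : ℕ} {δ ε : ℝ} {A B : Finset (Fin n)} (hAB : Disjoint A B)
    (hA : A.Nonempty) (hB : B.Nonempty) (hcard : A.card + B.card + s = n) (hm : 0 < m)
    (hs : (s : ℝ) = δ * n) (hδ : δ ∈ Set.Ioo (0 : ℝ) 1) (hε : ε ∈ Set.Ioo (0 : ℝ) 1) :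
    law (n * m) {x | EventW n m δ x.1 ∧ ∀ a ∈ A, ∀ b ∈ B, ¬ (graph x.1 x.2).Adj a b} ≤
      ENNReal.ofReal (2 * Real.exp
        (-(m : ℝ) * H n (1 / (2 * growth n)) ε δ A.card B.card)) := by
  have h1 : law (n * m) {x | EventW n m δ x.1 ∧ ∀ a ∈ A, ∀ b ∈ B, ¬ (graph x.1 x.2).Adj a b} ≤
      law (n * m) {x | x.1 ∈ {w | EventW n m δ w} ∧
        ∀ k, ∀ u ∈ crossing A B k, ¬ LeftEndIn x.1 x.2 k u} := by
    refine measure_mono_ae ?_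
    filter_upwards [ae_law_pos (n * m)] with x hx hx2
    exact ⟨hx2.1, fun k u hu => not_leftEndIn_of_not_adj hx hAB hx2.2 hu⟩
  refine h1.trans ((law_forall_notMem_le (measurableSet_eventW n m δ) (crossing A B)
    fun k u hu => lt_of_divNat_lt (Finset.mem_filter.1 hu).2.1).trans
    ((lintegral_eventW_exp_neg_le hs (by omega) hm hε.1.le A B).trans ?_))
  rw [← ENNReal.ofReal_add (Real.exp_pos _).le (Real.exp_pos _).le, two_mul (Real.exp _)]
  have hm' : (0 : ℝ) < m := by exact_mod_cast hm
  have hc : 0 < 1 / (2 * growth n) := by have := growth_pos n; positivity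
  have hK := mul_div_mul_sum_slope_sq_le hAB hA hB hδ hs
  have hg := g_le_sum_weight_mul_sum_weight hAB hcard
  rw [← sum_slope_opposite hAB] at hg
  have hP : 0 < ∑ i, slope s (opposite A B) i := by
    rw [sum_slope_opposite hAB]
    exact mul_pos (Finset.sum_pos (fun i _ => weight_pos _ _) hA)
      (Finset.sum_pos (fun i _ => weight_pos _ _) hB)
  have hQ : 0 < ∑ i, slope s (opposite A B) i ^ 2 := by
    obtain ⟨i, hi, hi'⟩ := Finset.exists_ne_zero_of_sum_ne_zero hP.ne'
    exact Finset.sum_pos' (fun _ _ => sq_nonneg _) ⟨i, hi, by positivity⟩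
  set P := ∑ i, slope s (opposite A B) i
  set Q := ∑ i, slope s (opposite A B) i ^ 2
  refine ENNReal.ofReal_le_ofReal (add_le_add (Real.exp_le_exp.2 ?_) (Real.exp_le_exp.2 ?_))
  · rw [neg_mul, neg_le_neg_iff]
    calc (m : ℝ) * H n (1 / (2 * growth n)) ε δ A.card B.card
        ≤ m * (1 / (2 * growth n) * (1 - ε) * g n A.card B.card) :=
          mul_le_mul_of_nonneg_left (min_le_right _ _) hm'.le
      _ ≤ m * (1 / (2 * growth n) * (1 - ε) * P) := by
          have := sub_pos.2 hε.2
          gcongr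
      _ = _ := by ring
  · rw [neg_mul, neg_le_neg_iff]
    set q := (A.card : ℝ) * B.card / ((A.card : ℝ) + B.card) with hq
    calc (m : ℝ) * H n (1 / (2 * growth n)) ε δ A.card B.card
        ≤ m * (2 * ε ^ 2 * √δ / (1 + √δ) ^ 2 * q) :=
          mul_le_mul_of_nonneg_left (min_le_left _ _) hm'.le
      _ = m * ε ^ 2 / 2 * (4 * √δ / (1 + √δ) ^ 2 * q) := by ring
      _ ≤ m * ε ^ 2 / 2 * (P ^ 2 / Q) := by
          gcongr
          rwa [le_div_iff₀ hQ]
      _ = _ := by field_simp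

/-- The union bound over all pairs of disjoint vertex sets. -/
lemma prob_le_sum (n m : ℕ) (δ : ℝ) (μ ν : ℕ) {b : ENNReal}
    (hb : ∀ A B : Finset (Fin n), A.card = μ → B.card = ν → Disjoint A B →
      law (n * m) {x | EventW n m δ x.1 ∧ ∀ a ∈ A, ∀ b ∈ B, ¬ (graph x.1 x.2).Adj a b} ≤ b) :
    prob n m δ μ ν ≤ (n.choose (μ + ν) * (μ + ν).choose μ : ℕ) * b := by
  have hsub : {x : (Fin (n * m + 1) → ℝ) × (Fin (n * m) → ℝ) |
      EventW n m δ x.1 ∧ HasSeparatedPair (graph x.1 x.2) μ ν} ⊆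
      ⋃ A ∈ Finset.powersetCard μ (Finset.univ : Finset (Fin n)), ⋃ B ∈ Finset.powersetCard ν Aᶜ,
        {x | EventW n m δ x.1 ∧ ∀ a ∈ A, ∀ b ∈ B, ¬ (graph x.1 x.2).Adj a b} := by
    rintro x ⟨hx, A, B, hA, hB, hAB, hadj⟩
    simp only [Set.mem_iUnion]
    exact ⟨A, Finset.mem_powersetCard.2 ⟨Finset.subset_univ _, hA⟩, B,
      Finset.mem_powersetCard.2 ⟨Finset.subset_compl_iff_disjoint_left.2 hAB, hB⟩, hx, hadj⟩
  refine (measure_mono hsub).trans ((measure_biUnion_finset_le _ _).trans ?_)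
  have hA : ∀ A ∈ Finset.powersetCard μ (Finset.univ : Finset (Fin n)),
      law (n * m) (⋃ B ∈ Finset.powersetCard ν Aᶜ,
        {x | EventW n m δ x.1 ∧ ∀ a ∈ A, ∀ b ∈ B, ¬ (graph x.1 x.2).Adj a b}) ≤
      ((n - μ).choose ν : ℕ) * b := by
    intro A hA
    refine (measure_biUnion_finset_le _ _).trans
      ((Finset.sum_le_card_nsmul _ _ b fun B hB => ?_).trans (le_of_eq ?_))
    · exact hb A B (Finset.mem_powersetCard.1 hA).2 (Finset.mem_powersetCard.1 hB).2
        (Finset.subset_compl_iff_disjoint_left.1 (Finset.mem_powersetCard.1 hB).1)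
    · rw [Finset.card_powersetCard, Finset.card_compl, (Finset.mem_powersetCard.1 hA).2,
        Fintype.card_fin, nsmul_eq_mul]
  refine (Finset.sum_le_card_nsmul _ _ _ hA).trans (le_of_eq ?_)
  rw [Finset.card_powersetCard, Finset.card_univ, Fintype.card_fin, nsmul_eq_mul, ← mul_assoc,
    Nat.choose_mul (Nat.le_add_right μ ν), Nat.add_sub_cancel_left, Nat.cast_mul]

end PairingModel

theorem mainTheorem5 :
    ∃ c : ℕ → ℝ, Tendsto c atTop (𝓝 (1 / 2)) ∧
      ∀ (n m : ℕ), 1 ≤ n → 1 ≤ m →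
      ∀ (μ ν : ℕ) (δ ε : ℝ), δ ∈ Set.Ioo (0 : ℝ) 1 → ε ∈ Set.Ioo (0 : ℝ) 1 →
        (μ : ℝ) + ν = (1 - δ) * n →
        PairingModel.prob n m δ μ ν ≤
          ENNReal.ofReal (2 * (n.choose (μ + ν) : ℝ) * ((μ + ν).choose μ : ℝ) *
            Real.exp (-(m : ℝ) * PairingModel.H n (c n) ε δ μ ν)) := by
  refine ⟨fun n => 1 / (2 * PairingModel.growth n), ?_, ?_⟩
  · have h := (PairingModel.tendsto_growth.const_mul 2).inv₀ (by norm_num)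
    simpa using h
  intro n m hn hm μ ν δ ε hδ hε hμν
  have hn' : (0 : ℝ) < n := by exact_mod_cast hn
  have hle : μ + ν ≤ n := by
    have h1 : ((μ + ν : ℕ) : ℝ) ≤ n := by push_cast; nlinarith [hδ.1]
    exact_mod_cast h1
  have hs : ((n - (μ + ν) : ℕ) : ℝ) = δ * n := by
    push_cast [hle]
    linarith
  have hcast : ENNReal.ofReal (2 * (n.choose (μ + ν) : ℝ) * ((μ + ν).choose μ : ℝ) *
      Real.exp (-(m : ℝ) * PairingModel.H n (1 / (2 * PairingModel.growth n)) ε δ μ ν)) =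
      (n.choose (μ + ν) * (μ + ν).choose μ : ℕ) * ENNReal.ofReal (2 * Real.exp
        (-(m : ℝ) * PairingModel.H n (1 / (2 * PairingModel.growth n)) ε δ μ ν)) := by
    rw [← ENNReal.ofReal_natCast, ← ENNReal.ofReal_mul (Nat.cast_nonneg _)]
    congr 1
    push_cast
    ring
  rw [hcast]
  refine PairingModel.prob_le_sum n m δ μ ν fun A B hA hB hAB => ?_
  -- If `μ` or `ν` vanishes, the first term of the minimum is `0` (with `0 / 0 = 0`), so the bound
  -- is at least `2` and holds trivially.
  rcases Nat.eq_zero_or_pos (μ * ν) with h0 | h0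
  · refine prob_le_one.trans ?_
    rw [ENNReal.one_le_ofReal]
    have h1 : PairingModel.H n (1 / (2 * PairingModel.growth n)) ε δ μ ν ≤ 0 := by
      refine (min_le_left _ _).trans (le_of_eq ?_)
      have : (μ : ℝ) * ν = 0 := by exact_mod_cast h0
      rw [this, zero_div, mul_zero]
    have h2 : (1 : ℝ) ≤ Real.exp
        (-(m : ℝ) * PairingModel.H n (1 / (2 * PairingModel.growth n)) ε δ μ ν) := by
      rw [Real.one_le_exp_iff, neg_mul, neg_nonneg]
      exact mul_nonpos_of_nonneg_of_nonpos (Nat.cast_nonneg m) h1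
    linarith
  · have hμ := Nat.pos_of_mul_pos_right h0
    have hν := Nat.pos_of_mul_pos_left h0
    subst hA hB
    exact PairingModel.law_separated_le hAB (Finset.card_pos.1 (by assumption))
      (Finset.card_pos.1 (by assumption)) (by omega) hm hs hδ hε
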